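/- Let $0<p<1$ with $p\neq 1/2$ be a known label marginal, $p(Y=1)=p$, $p(Y=-1)=1-p$. For $\eta=(\mu_1,\mu_{-1},\sigma_1,\sigma_{-1})\in\mathbb R^4$ with $\sigma_1,\sigma_{-1}>0$ let $$p_\eta(z)=p\,N(z;\mu_1,\sigma_1^2)+(1-p)\,N(z;\mu_{-1},\sigma_{-1}^2),\qquad z\in\mathbb R,$$ where $N(\cdot\,;\mu,\sigma^2)$ is the normal density with mean $\mu$ and variance $\sigma^2$. Let $E\subset\mathbb R\times\mathbb R\times(0,\infty)\times(0,\infty)$ be compact, and let $\hat\eta_n$ be a maximum likelihood estimator over $E$: for every $n$ and every sample $z=(z_1,\dots,z_n)\in\mathbb R^n$, $\hat\eta_n(z)$ is a maximizer over $\eta\in E$ of $\sum_{i=1}^n\log p_\eta(z_i)$ (any maximizer, if there are several). Then the convergence of the maximum likelihood estimator to the true parameter is uniform, in the following two senses. (1) Uniformly in $\eta_0\in E$: if under $P_{\eta_0}$ the variables $z_1,z_2,\dots$ are i.i.d. with density $p_{\eta_0}$, then for every $\varepsilon>0$ $$\lim_{n\to\infty}\ \sup_{\eta_0\in E}\ P_{\eta_0}\bigl(\exists\,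 m\ge n:\ \|\hat\eta_m(z_1,\dots,z_m)-\eta_0\|\ge\varepsilon\bigr)=0 .$$ (2) Uniformly in $\theta\in\Theta$: let $(X,Y)$ be a random element of $\mathbb R^d\times\{-1,1\}$ with $P(Y=1)=p$ and $P(Y=-1)=1-p$, and put $f_\theta(x)=\sum_{j=1}^d\theta_jx_j$. Let $\Theta\subset\mathbb R^d$ be a set such that for every $\theta\in\Theta$ and both $y\in\{-1,1\}$ the conditional law of $f_\theta(X)$ given $Y=y$ is $N(\mu_y(\theta),\sigma_y(\theta)^2)$, where $\eta(\theta)=(\mu_1(\theta),\mu_{-1}(\theta),\sigma_1(\theta),\sigma_{-1}(\theta))\in E$. Let $X^{(1)},X^{(2)},\dots$ be i.i.d. copies of $X$ (unlabeled data). Then, with probability $1$, $$\sup_{\theta\in\Theta}\ \bigl\|\hat\eta_n\bigl(f_\theta(X^{(1)}),\dots,f_\theta(X^{(n)})\bigr)-\eta(\theta)\bigr\|\longrightarrow 0\qquad(n\to\infty).$$ -/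

import Mathlib

open MeasureTheory ProbabilityTheory Filter Topology

open scoped ENNReal

/-- Parameters `η = (μ₁, μ₋₁, σ₁, σ₋₁)` of a two-component Gaussian mixture (component means and
component standard deviations), with the Euclidean norm of `ℝ⁴`. -/
abbrev MixParam : Type := EuclideanSpace ℝ (Fin 4)

namespace MixParam

/-- The mean `μ_y` of the component of the label `y`: coordinate 0 for `y = 1`, coordinate 1 for
`y = -1`. Only the labels `1` and `-1` are used. -/
def mean (η : MixParam) (y : ℤ) : ℝ := if y = 1 then η 0 else η 1

/-- The standard deviation `σ_y` of the component of the label `y`: coordinate 2 for `y = 1`,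
coordinate 3 for `y = -1`. -/
def sd (η : MixParam) (y : ℤ) : ℝ := if y = 1 then η 2 else η 3

/-- The variance `σ_y²`, as a nonnegative real. -/
noncomputable def var (η : MixParam) (y : ℤ) : NNReal := Real.toNNReal (η.sd y ^ 2)

end MixParam

noncomputable section

/-- The mixture density `p_η(z) = p(1) N(z; μ₁, σ₁²) + p(-1) N(z; μ₋₁, σ₋₁²)`, where `p = p(1)` is
the known probability of the label `1` and `p(-1) = 1 - p`. -/
def mixPDF (p : ℝ) (η : MixParam) (z : ℝ) : ℝ :=
  p * gaussianPDFReal (η.mean 1) (η.var 1) z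
    + (1 - p) * gaussianPDFReal (η.mean (-1)) (η.var (-1)) z

/-- The mixture distribution `p(1) N(μ₁, σ₁²) + p(-1) N(μ₋₁, σ₋₁²)` on the real line. -/
def mixMeasure (p : ℝ) (η : MixParam) : Measure ℝ :=
  ENNReal.ofReal p • gaussianReal (η.mean 1) (η.var 1)
    + ENNReal.ofReal (1 - p) • gaussianReal (η.mean (-1)) (η.var (-1))

/-- The loglikelihood `ℓ_n(η) = ∑ᵢ log p_η(zᵢ)` of an unlabeled sample `z₁, …, z_n`. -/
def mixLogLik (p : ℝ) {n : ℕ} (z : Fin n → ℝ) (η : MixParam) : ℝ :=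
  ∑ i, Real.log (mixPDF p η (z i))

/-- `etaHat` is a maximum likelihood estimator over the parameter set `E`: for every sample size
`n` and every sample `z` of this size, `etaHat n z` is a maximizer of the loglikelihood of `z`
over `E` (an arbitrary one, if there are several). -/
def IsMixMLE (p : ℝ) (E : Set MixParam) (etaHat : (n : ℕ) → (Fin n → ℝ) → MixParam) : Prop :=
  ∀ (n : ℕ) (z : Fin n → ℝ), etaHat n z ∈ E ∧ IsMaxOn (mixLogLik p z) E (etaHat n z)

/-- The score `f_θ(x) = ∑ⱼ θⱼ xⱼ` of a linear classifier. -/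
def linScore {d : ℕ} (θ x : EuclideanSpace ℝ (Fin d)) : ℝ := ∑ j, θ j * x j

/-- Under the joint law `ρ` of `(X, Y)`, the conditional law of `f_θ(X)` given `Y = y` is
`N(μ_y, σ_y²)` for both labels `y ∈ {-1, 1}`, where `η = (μ₁, μ₋₁, σ₁, σ₋₁)`. -/
def ScoreIsNormalGivenLabel {d : ℕ} (ρ : Measure (EuclideanSpace ℝ (Fin d) × ℤ))
    (θ : EuclideanSpace ℝ (Fin d)) (η : MixParam) : Prop :=
  ∀ y : ℤ, (y = 1 ∨ y = -1) →
    (ProbabilityTheory.cond ρ (Prod.snd ⁻¹' {y})).map (fun xy => linScore θ xy.1)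
      = gaussianReal (η.mean y) (η.var y)

end

/-! The argument is Wald's consistency proof, with each uniformity made a single strong law in a
Banach space of continuous functions.

Identifiability: Gaussian densities, ordered lexicographically by (standard deviation, mean), are
strictly ordered by growth at `+∞`, hence linearly independent. Unequal weights `p` and `1 - p` then
rule out swapping the labels (`mixPDF_injective`). With the strict Gibbs inequality, the expected
log-likelihood under `η₀` has its unique maximum at `η₀`. By compactness the loss is bounded below
over all pairs in `E` at distance at least `ε`, so an empirical log-likelihood close enough to its
expectation, in sup norm over `E`, forces the estimate within `ε` of `η₀`
(`exists_pos_forall_norm_mle_sub_lt`). This step is deterministic.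

Probability enters through `strong_law_scoreMap`, a law of large numbers in sup norm over linear
scores with coefficients in a ball. For (1), every mixture is the law of a linear score under one
fixed measure on `ℝ⁴`, so one event of small probability controls all `η₀`. For (2), `Θ` may be
unbounded and `X` need not have a second moment, but the scores are bounded in `L²`; orthonormal
coordinates on the finite-dimensional space of square integrable scores bring the coefficients into
a ball. -/

/-! ### Identifiability of the mixture -/

open Asymptotics in
-- In a vanishing combination the term of largest index dominates all others, so its coefficient is
-- zero; induction removes it.
theorem linearIndependent_of_isLittleO {ι : Type*} [LinearOrder ι] {f : ι → ℝ → ℝ}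
    (hpos : ∀ i z, 0 < f i z) (h : ∀ i j, i < j → f i =o[atTop] f j) :
    LinearIndependent ℝ f := by
  rw [linearIndependent_iff']
  intro s
  induction s using Finset.induction_on_max with
  | empty => simp
  | insert a s ha ih =>
    intro g hg
    have has : a ∉ s := fun h => lt_irrefl _ (ha a h)
    rw [Finset.sum_insert has] at hg
    have hsum : (∑ i ∈ s, g i • f i) =o[atTop] f a := by
      have : (fun z => ∑ i ∈ s, g i * f i z) =o[atTop] f a :=
        IsLittleO.fun_sum fun i hi => (h i a (ha i hi)).const_mul_left _
      refine this.congr_left fun z => ?_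
      simp
    have hga : g a = 0 := by
      by_contra hne
      have h1 : (fun z => g a * f a z) =o[atTop] f a := by
        refine hsum.neg_left.congr_left fun z => ?_
        have := congrFun hg z
        simp only [Pi.add_apply, Pi.smul_apply, smul_eq_mul, Pi.zero_apply] at this
        linarith
      rw [isLittleO_const_mul_left_iff hne] at h1
      exact isLittleO_irrefl (Frequently.of_forall fun z => (hpos a z).ne') h1
    rw [hga, zero_smul, zero_add] at hg
    intro i hi
    rcases Finset.mem_insert.1 hi with rfl | hi
    · exact hga
    · exact ih g hg i hi

theorem gaussianPDFReal_toNNReal_sq (m s z : ℝ) :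
    gaussianPDFReal m (Real.toNNReal (s ^ 2)) z
      = (Real.sqrt (2 * Real.pi * s ^ 2))⁻¹ * Real.exp (-(z - m) ^ 2 / (2 * s ^ 2)) := by
  rw [gaussianPDFReal, Real.coe_toNNReal _ (sq_nonneg s)]

theorem toNNReal_sq_ne_zero {s : ℝ} (hs : 0 < s) : Real.toNNReal (s ^ 2) ≠ 0 := by
  have : 0 < s ^ 2 := by positivity
  simpa using this.not_ge

-- The difference of the exponents is a polynomial in `z`: quadratic with positive leading
-- coefficient if `s < s'`, linear with positive slope if `s = s'` and `m < m'`.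
open Asymptotics in
theorem isLittleO_gaussianPDFReal {m s m' s' : ℝ} (hs : 0 < s) (hs' : 0 < s')
    (h : s < s' ∨ s = s' ∧ m < m') :
    gaussianPDFReal m (Real.toNNReal (s ^ 2))
      =o[atTop] gaussianPDFReal m' (Real.toNNReal (s' ^ 2)) := by
  simp_rw [funext fun z => gaussianPDFReal_toNNReal_sq m s z,
    funext fun z => gaussianPDFReal_toNNReal_sq m' s' z]
  refine IsLittleO.const_mul_left ?_ _
  rw [isLittleO_const_mul_right_iff (by positivity), Real.isLittleO_exp_comp_exp_comp]
  rcases h with h | ⟨rfl, h⟩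
  · have ha : 0 < 1 / (2 * s ^ 2) - 1 / (2 * s' ^ 2) := by
      rw [sub_pos]
      gcongr
    have : Tendsto (fun z : ℝ => z * ((1 / (2 * s ^ 2) - 1 / (2 * s' ^ 2)) * z
        + (m' / s' ^ 2 - m / s ^ 2)) + (m ^ 2 / (2 * s ^ 2) - m' ^ 2 / (2 * s' ^ 2)))
        atTop atTop :=
      tendsto_atTop_add_const_right _ _ (tendsto_id.atTop_mul_atTop₀
        (tendsto_atTop_add_const_right _ _ (tendsto_id.const_mul_atTop ha)))
    refine this.congr fun z => ?_
    field_simp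
    ring
  · have ha : 0 < (m' - m) / s ^ 2 := div_pos (sub_pos.2 h) (by positivity)
    have : Tendsto (fun z : ℝ => (m' - m) / s ^ 2 * z + (m ^ 2 - m' ^ 2) / (2 * s ^ 2))
        atTop atTop :=
      tendsto_atTop_add_const_right _ _ (tendsto_id.const_mul_atTop ha)
    refine this.congr fun z => ?_
    field_simp
    ring

/-- Gaussian densities with distinct (standard deviation, mean) are linearly independent. -/
theorem linearIndependent_gaussianPDFReal :
    LinearIndependent ℝ (fun x : {x : ℝ ×ₗ ℝ // 0 < (ofLex x).1} =>
      gaussianPDFReal (ofLex x.1).2 (Real.toNNReal ((ofLex x.1).1 ^ 2))) := by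
  refine linearIndependent_of_isLittleO
    (fun x z => gaussianPDFReal_pos _ _ _ (toNNReal_sq_ne_zero x.2)) fun x y hxy => ?_
  refine isLittleO_gaussianPDFReal x.2 y.2 ?_
  have := Prod.Lex.lt_iff.1 (show x.1 < y.1 from hxy)
  exact this

/-- The weights tell the two atoms apart because `p ≠ 1 - p`. The case `a = b`, where they merge
into one atom of weight 1, is included. -/
theorem single_add_single_injective {ι : Type*} {p : ℝ} (hp0 : 0 < p) (hp1 : p < 1)
    (hp : p ≠ 1 - p) {a b a' b' : ι}
    (h : Finsupp.single a p + Finsupp.single b (1 - p)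
      = Finsupp.single a' p + Finsupp.single b' (1 - p)) : a = a' ∧ b = b' := by
  classical
  have h1 : (1 : ℝ) - p ≠ 0 := by linarith
  have key := fun x => DFunLike.congr_fun h x
  simp only [Finsupp.add_apply, Finsupp.single_apply] at key
  have ka := key a
  have kb := key b
  have ka' := key a'
  by_cases e1 : a = a'
  · subst e1
    refine ⟨rfl, ?_⟩
    by_contra e2
    have e3 : b' ≠ b := fun h => e2 h.symm
    simp only [e3, if_true, if_false] at kb
    exact h1 (by linarith)
  · exfalso
    have e1' : a' ≠ a := fun h => e1 h.symm
    by_cases e2 : b' = a <;> by_cases e3 : b = a' <;> by_cases e4 : b = a <;>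
      by_cases e5 : b' = a' <;>
      simp [e1, e1', e2, e3, e4, e5] at ka ka' <;> (apply hp; linarith)

namespace MixParam

theorem ext_mean_sd {η η' : MixParam} (h1 : η.mean 1 = η'.mean 1)
    (h2 : η.mean (-1) = η'.mean (-1)) (h3 : η.sd 1 = η'.sd 1) (h4 : η.sd (-1) = η'.sd (-1)) :
    η = η' := by
  ext i
  fin_cases i
  exacts [h1, h2, h3, h4]

theorem var_ne_zero {η : MixParam} {y : ℤ} (h : 0 < η.sd y) : η.var y ≠ 0 :=
  toNNReal_sq_ne_zero h

end MixParam

theorem mixPDF_injective {p : ℝ} (hp0 : 0 < p) (hp1 : p < 1) (hp : p ≠ 1 - p) {η η' : MixParam}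
    (hη : 0 < η.sd 1 ∧ 0 < η.sd (-1)) (hη' : 0 < η'.sd 1 ∧ 0 < η'.sd (-1))
    (h : mixPDF p η = mixPDF p η') : η = η' := by
  let pt : (η : MixParam) → (y : ℤ) → 0 < η.sd y → {x : ℝ ×ₗ ℝ // 0 < (ofLex x).1} :=
    fun η y hy => ⟨toLex (η.sd y, η.mean y), hy⟩
  have key := linearIndependent_gaussianPDFReal
    (a₁ := Finsupp.single (pt η 1 hη.1) p + Finsupp.single (pt η (-1) hη.2) (1 - p))
    (a₂ := Finsupp.single (pt η' 1 hη'.1) p + Finsupp.single (pt η' (-1) hη'.2) (1 - p)) (by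
      simp only [map_add, Finsupp.linearCombination_single]
      exact h)
  obtain ⟨h1, h2⟩ := single_add_single_injective hp0 hp1 hp key
  have e := fun {x y : {x : ℝ ×ₗ ℝ // 0 < (ofLex x).1}} (h : x = y) => congrArg (ofLex ·.1) h
  exact MixParam.ext_mean_sd (congrArg Prod.snd (e h1)) (congrArg Prod.snd (e h2))
    (congrArg Prod.fst (e h1)) (congrArg Prod.fst (e h2))

/-! ### Mixture densities and the Gibbs inequality -/

theorem mixPDF_pos {p : ℝ} (hp0 : 0 < p) (hp1 : p < 1) {η : MixParam}
    (hη : 0 < η.sd 1 ∧ 0 < η.sd (-1)) (z : ℝ) : 0 < mixPDF p η z := by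
  have h1 := gaussianPDFReal_pos (η.mean 1) _ z (MixParam.var_ne_zero hη.1)
  have h2 := gaussianPDFReal_pos (η.mean (-1)) _ z (MixParam.var_ne_zero hη.2)
  have : 0 < 1 - p := by linarith
  unfold mixPDF
  positivity

theorem continuous_gaussianPDFReal (m : ℝ) (v : NNReal) : Continuous (gaussianPDFReal m v) := by
  unfold gaussianPDFReal
  fun_prop

theorem continuous_mixPDF (p : ℝ) (η : MixParam) : Continuous (mixPDF p η) :=
  ((continuous_gaussianPDFReal _ _).const_mul _).add
    ((continuous_gaussianPDFReal _ _).const_mul _)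

theorem integrable_mixPDF (p : ℝ) (η : MixParam) : Integrable (mixPDF p η) :=
  ((integrable_gaussianPDFReal _ _).const_mul _).add
    ((integrable_gaussianPDFReal _ _).const_mul _)

theorem integral_mixPDF (p : ℝ) {η : MixParam} (hη : 0 < η.sd 1 ∧ 0 < η.sd (-1)) :
    ∫ z, mixPDF p η z = 1 := by
  unfold mixPDF
  rw [integral_add ((integrable_gaussianPDFReal _ _).const_mul _)
    ((integrable_gaussianPDFReal _ _).const_mul _), integral_const_mul, integral_const_mul,
    integral_gaussianPDFReal_eq_one _ (MixParam.var_ne_zero hη.1),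
    integral_gaussianPDFReal_eq_one _ (MixParam.var_ne_zero hη.2)]
  ring

theorem mixMeasure_eq_withDensity {p : ℝ} (hp0 : 0 < p) (hp1 : p < 1) {η : MixParam}
    (hη : 0 < η.sd 1 ∧ 0 < η.sd (-1)) :
    mixMeasure p η = volume.withDensity (fun z => ENNReal.ofReal (mixPDF p η z)) := by
  rw [mixMeasure, gaussianReal_of_var_ne_zero _ (MixParam.var_ne_zero hη.1),
    gaussianReal_of_var_ne_zero _ (MixParam.var_ne_zero hη.2),
    ← withDensity_smul _ (measurable_gaussianPDF _ _),
    ← withDensity_smul _ (measurable_gaussianPDF _ _),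
    ← withDensity_add_left ((measurable_gaussianPDF _ _).const_smul _)]
  congr 1
  ext z
  have h1 := gaussianPDFReal_nonneg (η.mean 1) (η.var 1) z
  have h2 := gaussianPDFReal_nonneg (η.mean (-1)) (η.var (-1)) z
  have h3 : 0 ≤ 1 - p := by linarith
  simp only [Pi.add_apply, Pi.smul_apply, smul_eq_mul, mixPDF, gaussianPDF]
  rw [ENNReal.ofReal_add (by positivity) (by positivity), ENNReal.ofReal_mul hp0.le,
    ENNReal.ofReal_mul h3]

theorem integral_mixMeasure {p : ℝ} (hp0 : 0 < p) (hp1 : p < 1) {η : MixParam}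
    (hη : 0 < η.sd 1 ∧ 0 < η.sd (-1)) (f : ℝ → ℝ) :
    ∫ z, f z ∂(mixMeasure p η) = ∫ z, mixPDF p η z * f z := by
  rw [mixMeasure_eq_withDensity hp0 hp1 hη, integral_withDensity_eq_integral_toReal_smul
    (continuous_mixPDF p η).measurable.ennreal_ofReal (by simp)]
  simp [ENNReal.toReal_ofReal (mixPDF_pos hp0 hp1 hη _).le]

theorem integrable_mixMeasure_iff {p : ℝ} (hp0 : 0 < p) (hp1 : p < 1) {η : MixParam}
    (hη : 0 < η.sd 1 ∧ 0 < η.sd (-1)) (f : ℝ → ℝ) :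
    Integrable f (mixMeasure p η) ↔ Integrable (fun z => mixPDF p η z * f z) := by
  rw [mixMeasure_eq_withDensity hp0 hp1 hη, integrable_withDensity_iff_integrable_smul'
    (continuous_mixPDF p η).measurable.ennreal_ofReal (by simp)]
  simp [ENNReal.toReal_ofReal (mixPDF_pos hp0 hp1 hη _).le]

/-- Strict Gibbs inequality for the mixture densities. -/
theorem integral_log_mixPDF_lt {p : ℝ} (hp0 : 0 < p) (hp1 : p < 1) (hp : p ≠ 1 - p)
    {η η₀ : MixParam} (hη : 0 < η.sd 1 ∧ 0 < η.sd (-1)) (hη₀ : 0 < η₀.sd 1 ∧ 0 < η₀.sd (-1))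
    (hne : η ≠ η₀)
    (h : Integrable (fun z => Real.log (mixPDF p η z)) (mixMeasure p η₀))
    (h₀ : Integrable (fun z => Real.log (mixPDF p η₀ z)) (mixMeasure p η₀)) :
    ∫ z, Real.log (mixPDF p η z) ∂(mixMeasure p η₀)
      < ∫ z, Real.log (mixPDF p η₀ z) ∂(mixMeasure p η₀) := by
  by_contra hcon
  rw [not_lt, integral_mixMeasure hp0 hp1 hη₀, integral_mixMeasure hp0 hp1 hη₀] at hcon
  rw [integrable_mixMeasure_iff hp0 hp1 hη₀] at h h₀
  have pos := mixPDF_pos hp0 hp1 hη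
  have pos₀ := mixPDF_pos hp0 hp1 hη₀
  -- Both densities integrate to 1, so the integral of `F` is the difference of expected
  -- log-likelihoods, at most 0 by `hcon`. Yet `F ≥ 0` by `log x ≤ x - 1`. Hence `F` vanishes a.e.,
  -- everywhere by continuity, and the equality case makes the densities equal.
  let F : ℝ → ℝ := fun z => (mixPDF p η z - mixPDF p η₀ z)
    - (mixPDF p η₀ z * Real.log (mixPDF p η z) - mixPDF p η₀ z * Real.log (mixPDF p η₀ z))
  have hFeq : ∀ z, F z = mixPDF p η₀ z
      * (mixPDF p η z / mixPDF p η₀ z - 1 - Real.log (mixPDF p η z / mixPDF p η₀ z)) := by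
    intro z
    have := (pos₀ z).ne'
    rw [Real.log_div (pos z).ne' this]
    simp only [F]
    field_simp
  have hF0 : 0 ≤ F := fun z => by
    rw [hFeq z]
    exact mul_nonneg (pos₀ z).le
      (sub_nonneg.2 (Real.log_le_sub_one_of_pos (div_pos (pos z) (pos₀ z))))
  have hint : Integrable F :=
    ((integrable_mixPDF p η).sub (integrable_mixPDF p η₀)).sub (h.sub h₀)
  have hFint : ∫ z, F z ≤ 0 := by
    have h1 := (integral_sub ((integrable_mixPDF p η).sub (integrable_mixPDF p η₀))
      (h.sub h₀)).trans (congrArg₂ (· - ·) (integral_sub (integrable_mixPDF p η)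
        (integrable_mixPDF p η₀)) (integral_sub h h₀))
    rw [integral_mixPDF p hη, integral_mixPDF p hη₀] at h1
    refine (h1.trans_le ?_ : ∫ z, F z ≤ 0)
    linarith
  have hFae : F =ᵐ[volume] 0 :=
    (integral_eq_zero_iff_of_nonneg hF0 hint).1 (le_antisymm hFint (integral_nonneg hF0))
  have hFc : Continuous F := by
    have c1 := continuous_mixPDF p η
    have c2 := continuous_mixPDF p η₀
    exact (c1.sub c2).sub ((c2.mul (c1.log fun z => (pos z).ne')).sub
      (c2.mul (c2.log fun z => (pos₀ z).ne')))
  have hFz : F = 0 := (hFc.ae_eq_iff_eq volume continuous_const).1 hFae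
  refine hne (mixPDF_injective hp0 hp1 hp hη hη₀ (funext fun z => ?_))
  by_contra hz
  have h1 : mixPDF p η z / mixPDF p η₀ z ≠ 1 := by
    rwa [Ne, div_eq_one_iff_eq (pos₀ z).ne']
  have h2 := Real.log_lt_sub_one_of_pos (div_pos (pos z) (pos₀ z)) h1
  have h3 : F z = 0 := congrFun hFz z
  rw [hFeq z] at h3
  have := mul_pos (pos₀ z) (sub_pos.2 h2)
  linarith

/-! ### Quadratic growth of the log-density, uniformly on `E` -/

theorem abs_log_gaussianPDFReal_le {s : ℝ} (hs : 0 < s) (m z : ℝ) :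
    |Real.log (gaussianPDFReal m (Real.toNNReal (s ^ 2)) z)|
      ≤ (|Real.log (Real.sqrt (2 * Real.pi * s ^ 2))| + (1 + m ^ 2) / s ^ 2) * (1 + z ^ 2) := by
  rw [gaussianPDFReal_toNNReal_sq, Real.log_mul (by positivity) (Real.exp_ne_zero _),
    Real.log_exp, Real.log_inv]
  set l := Real.log (Real.sqrt (2 * Real.pi * s ^ 2))
  have h1 : |-(z - m) ^ 2 / (2 * s ^ 2)| ≤ (1 + m ^ 2) / s ^ 2 * (1 + z ^ 2) := by
    rw [neg_div, abs_neg, abs_of_nonneg (by positivity), div_mul_eq_mul_div,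
      div_le_div_iff₀ (by positivity) (by positivity)]
    have : (z - m) ^ 2 ≤ 2 * ((1 + m ^ 2) * (1 + z ^ 2)) := by
      nlinarith [sq_nonneg (z + m), mul_nonneg (sq_nonneg z) (sq_nonneg m)]
    nlinarith [sq_nonneg s]
  have h2 : |l| ≤ |l| * (1 + z ^ 2) :=
    le_mul_of_one_le_right (abs_nonneg _) (by nlinarith [sq_nonneg z])
  calc |-l + -(z - m) ^ 2 / (2 * s ^ 2)| ≤ |-l| + |-(z - m) ^ 2 / (2 * s ^ 2)| := abs_add_le _ _
    _ ≤ _ := by rw [abs_neg, add_mul]; exact add_le_add h2 h1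

/-- The interval `[exp (-t), exp t]` is convex. -/
theorem abs_log_convexCombination_le {p a b t : ℝ} (hp0 : 0 < p) (hp1 : p < 1) (ha : 0 < a)
    (hb : 0 < b) (hat : |Real.log a| ≤ t) (hbt : |Real.log b| ≤ t) :
    |Real.log (p * a + (1 - p) * b)| ≤ t := by
  have hq : 0 < 1 - p := by linarith
  rw [abs_le] at hat hbt ⊢
  rw [Real.le_log_iff_exp_le ha, Real.log_le_iff_le_exp ha] at hat
  rw [Real.le_log_iff_exp_le hb, Real.log_le_iff_le_exp hb] at hbt
  rw [Real.le_log_iff_exp_le (by positivity), Real.log_le_iff_le_exp (by positivity)]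
  constructor <;> nlinarith

/-- The log-density of the mixture as a continuous curve in `C(E, ℝ)`, of quadratic growth. -/
theorem exists_logMixPDF_curve {p : ℝ} (hp0 : 0 < p) (hp1 : p < 1) {E : Set MixParam}
    (hE : IsCompact E) (hEsd : ∀ η ∈ E, 0 < η.sd 1 ∧ 0 < η.sd (-1)) :
    ∃ (g : C(ℝ, C(E, ℝ))) (C : ℝ), 0 ≤ C ∧ (∀ z η, g z η = Real.log (mixPDF p η z)) ∧
      ∀ z (η : E), |g z η| ≤ C * (1 + z ^ 2) := by
  have hc : Continuous fun q : ℝ × E => Real.log (mixPDF p q.2 q.1) := by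
    refine Continuous.log ?_ fun q => (mixPDF_pos hp0 hp1 (hEsd _ q.2.2) _).ne'
    have h2 : ∀ q : ℝ × E, (q.2 : MixParam) 2 ≠ 0 := fun q => (hEsd _ q.2.2).1.ne'
    have h3 : ∀ q : ℝ × E, (q.2 : MixParam) 3 ≠ 0 := fun q => (hEsd _ q.2.2).2.ne'
    have key : ∀ i j : Fin 4, (∀ q : ℝ × E, (q.2 : MixParam) j ≠ 0) →
        Continuous fun q : ℝ × E =>
          gaussianPDFReal ((q.2 : MixParam) i) (Real.toNNReal ((q.2 : MixParam) j ^ 2)) q.1 := by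
      intro i j hj
      simp_rw [gaussianPDFReal_toNNReal_sq]
      refine Continuous.mul (Continuous.inv₀ (by fun_prop) fun q => ?_)
        (Real.continuous_exp.comp (Continuous.div (by fun_prop) (by fun_prop) fun q => ?_))
      · have := hj q
        positivity
      · have := hj q
        positivity
    exact ((key 0 2 h2).const_mul p).add ((key 1 3 h3).const_mul (1 - p))
  let D : MixParam → ℝ := fun η =>
    (|Real.log (Real.sqrt (2 * Real.pi * η 2 ^ 2))| + (1 + η 0 ^ 2) / η 2 ^ 2)
      + (|Real.log (Real.sqrt (2 * Real.pi * η 3 ^ 2))| + (1 + η 1 ^ 2) / η 3 ^ 2)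
  have hD : ContinuousOn D E := by
    have h2 : ∀ η ∈ E, η 2 ≠ 0 := fun η h => (hEsd η h).1.ne'
    have h3 : ∀ η ∈ E, η 3 ≠ 0 := fun η h => (hEsd η h).2.ne'
    have key : ∀ i j : Fin 4, (∀ η ∈ E, η j ≠ 0) → ContinuousOn (fun η : MixParam =>
        |Real.log (Real.sqrt (2 * Real.pi * η j ^ 2))| + (1 + η i ^ 2) / η j ^ 2) E := by
      intro i j hj
      refine ContinuousOn.add (ContinuousOn.abs (ContinuousOn.log (by fun_prop) fun η h => ?_))
        (ContinuousOn.div (by fun_prop) (by fun_prop) fun η h => ?_)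
      · have := hj η h
        positivity
      · have := hj η h
        positivity
    exact (key 0 2 h2).add (key 1 3 h3)
  obtain ⟨C, hC⟩ := hE.exists_bound_of_continuousOn hD
  refine ⟨ContinuousMap.curry ⟨_, hc⟩, |C|, abs_nonneg _, fun z η => rfl, fun z η => ?_⟩
  obtain ⟨hs1, hs2⟩ := hEsd η η.2
  have b1 := abs_log_gaussianPDFReal_le hs1 (η.1 0) z
  have b2 := abs_log_gaussianPDFReal_le hs2 (η.1 1) z
  have n1 := (abs_nonneg _).trans b1
  have n2 := (abs_nonneg _).trans b2
  have hCη : D η ≤ |C| := (le_abs_self _).trans ((hC η η.2).trans (le_abs_self _))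
  refine (abs_log_convexCombination_le hp0 hp1
    (gaussianPDFReal_pos _ _ z (MixParam.var_ne_zero hs1))
    (gaussianPDFReal_pos _ _ z (MixParam.var_ne_zero hs2))
    (t := D η * (1 + z ^ 2)) ?_ ?_).trans
    (mul_le_mul_of_nonneg_right hCη (by positivity))
  · refine b1.trans ?_
    simp only [D, add_mul _ _ (1 + z ^ 2)] at n1 n2 ⊢
    exact le_add_of_nonneg_right n2
  · refine b2.trans ?_
    simp only [D, add_mul _ _ (1 + z ^ 2)] at n1 n2 ⊢
    exact le_add_of_nonneg_left n1

/-! ### Uniform strong law over linear scores -/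

theorem continuous_linScore {d : ℕ} :
    Continuous fun q : EuclideanSpace ℝ (Fin d) × EuclideanSpace ℝ (Fin d) =>
      linScore q.2 q.1 := by
  unfold linScore
  fun_prop

theorem measurable_linScore {d : ℕ} (θ : EuclideanSpace ℝ (Fin d)) : Measurable (linScore θ) :=
  (continuous_linScore.comp (by fun_prop : Continuous fun x => (x, θ))).measurable

theorem linScore_eq_inner {d : ℕ} (θ x : EuclideanSpace ℝ (Fin d)) :
    linScore θ x = inner ℝ x θ := by
  simp [linScore, PiLp.inner_apply]

theorem abs_linScore_le {d : ℕ} (θ x : EuclideanSpace ℝ (Fin d)) :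
    |linScore θ x| ≤ ‖θ‖ * ‖x‖ := by
  rw [linScore_eq_inner, mul_comm]
  exact abs_real_inner_le_norm x θ

section UniformLaw

variable {d : ℕ} {Y : Type*} [NormedAddCommGroup Y]

/-- For `g : ℝ → Y`, the map sending `x` to the function `θ ↦ g (f_θ(x))` on a closed ball. -/
def scoreMap (R : ℝ) (g : C(ℝ, Y)) :
    C(EuclideanSpace ℝ (Fin d), C(Metric.closedBall (0 : EuclideanSpace ℝ (Fin d)) R, Y)) :=
  ContinuousMap.curry ⟨fun q => g (linScore (q.2 : EuclideanSpace ℝ (Fin d)) q.1),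
    g.continuous.comp (continuous_linScore.comp
      (continuous_fst.prodMk (continuous_subtype_val.comp continuous_snd)))⟩

@[simp]
theorem scoreMap_apply (R : ℝ) (g : C(ℝ, Y)) (x : EuclideanSpace ℝ (Fin d))
    (θ : Metric.closedBall (0 : EuclideanSpace ℝ (Fin d)) R) :
    scoreMap R g x θ = g (linScore θ x) := rfl

/-- By Cauchy–Schwarz the sup norm of `scoreMap R g x` is at most `C * (1 + R ^ 2 * ‖x‖ ^ 2)`, so a
second moment suffices. -/
theorem integrable_scoreMap {R : ℝ} {g : C(ℝ, Y)} {C : ℝ} (hC : 0 ≤ C)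
    (hg : ∀ z, ‖g z‖ ≤ C * (1 + z ^ 2)) {ν : Measure (EuclideanSpace ℝ (Fin d))}
    [IsFiniteMeasure ν] (hν : MemLp id 2 ν) : Integrable (scoreMap R g) ν := by
  have h2 : Integrable (fun x : EuclideanSpace ℝ (Fin d) => ‖x‖ ^ 2) ν :=
    hν.integrable_norm_pow (by norm_num)
  refine Integrable.mono' (((integrable_const (1 : ℝ)).add (h2.const_mul (R ^ 2))).const_mul C)
    (scoreMap R g).continuous.aestronglyMeasurable (ae_of_all _ fun x => ?_)
  have h0 : 0 ≤ C * (1 + R ^ 2 * ‖x‖ ^ 2) := by positivity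
  refine (ContinuousMap.norm_le _ h0).2 fun θ => (hg _).trans ?_
  have hθ : ‖(θ : EuclideanSpace ℝ (Fin d))‖ ≤ R := mem_closedBall_zero_iff.1 θ.2
  have : linScore (θ : EuclideanSpace ℝ (Fin d)) x ^ 2 ≤ R ^ 2 * ‖x‖ ^ 2 := by
    rw [← mul_pow, ← sq_abs]
    gcongr
    exact (abs_linScore_le _ _).trans (by gcongr)
  gcongr

variable [NormedSpace ℝ Y] [CompleteSpace Y]

theorem integral_scoreMap_apply {R : ℝ} {g : C(ℝ, Y)} {ν : Measure (EuclideanSpace ℝ (Fin d))}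
    (hint : Integrable (scoreMap R g) ν)
    (θ : Metric.closedBall (0 : EuclideanSpace ℝ (Fin d)) R) :
    (∫ x, scoreMap R g x ∂ν) θ
      = ∫ z, g z ∂(ν.map (linScore (θ : EuclideanSpace ℝ (Fin d)))) := by
  rw [integral_map (measurable_linScore _).aemeasurable
    g.continuous.stronglyMeasurable.aestronglyMeasurable]
  exact ContinuousMap.integral_apply hint θ

/-- Strong law of large numbers, uniform over the linear scores in a ball. -/
theorem strong_law_scoreMap {R : ℝ} {g : C(ℝ, Y)} {ν : Measure (EuclideanSpace ℝ (Fin d))}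
    (hint : Integrable (scoreMap R g) ν) {Ω : Type*} [MeasurableSpace Ω] {P : Measure Ω}
    {Z : ℕ → Ω → EuclideanSpace ℝ (Fin d)} (hind : iIndepFun Z P) (hZ : ∀ i, HasLaw (Z i) ν P) :
    ∀ᵐ ω ∂P, Tendsto (fun n : ℕ => (n : ℝ)⁻¹ • ∑ i ∈ Finset.range n, scoreMap R g (Z i ω)) atTop
      (𝓝 (∫ x, scoreMap R g x ∂ν)) := by
  borelize C(Metric.closedBall (0 : EuclideanSpace ℝ (Fin d)) R, Y)
  have hm : Measurable (scoreMap (d := d) R g) := (scoreMap R g).continuous.measurable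
  have h0 : Integrable (scoreMap R g ∘ Z 0) P := by
    rw [← integrable_map_measure _ (hZ 0).aemeasurable]
    · rwa [(hZ 0).map_eq]
    · exact (scoreMap R g).continuous.aestronglyMeasurable
  -- The strong law holds for Banach-valued variables; taken in the space of continuous functions on
  -- the ball, its norm convergence is the uniformity in `θ`.
  have key := strong_law_ae (μ := P) (fun i => scoreMap R g ∘ Z i) h0
    (fun i j hij => (hind.indepFun hij).comp hm hm) (fun i =>
      (⟨(hZ i).aemeasurable, (hZ 0).aemeasurable, by rw [(hZ i).map_eq, (hZ 0).map_eq]⟩ :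
        IdentDistrib (Z i) (Z 0) P P).comp hm)
  have hlim : ∫ ω, (scoreMap R g ∘ Z 0) ω ∂P = ∫ x, scoreMap R g x ∂ν := by
    rw [← (hZ 0).map_eq, integral_map (hZ 0).aemeasurable
      (scoreMap R g).continuous.aestronglyMeasurable]
    rfl
  rw [hlim] at key
  exact key

end UniformLaw

/-! ### All mixtures as linear scores of one law -/

/-- A law on `ℝ⁴` whose linear scores realize every mixture with the label marginal `p`. -/
noncomputable def couplingMeasure (p : ℝ) : Measure (EuclideanSpace ℝ (Fin 4)) :=
  ENNReal.ofReal p • (gaussianReal 0 1).map (fun u => !₂[u, 1, 0, 0])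
    + ENNReal.ofReal (1 - p) • (gaussianReal 0 1).map (fun u => !₂[0, 0, u, 1])

/-- The coefficients of the linear score with law `mixMeasure p η` under `couplingMeasure p`. -/
noncomputable def couplingVec (η : MixParam) : EuclideanSpace ℝ (Fin 4) := !₂[η 2, η 0, η 3, η 1]

theorem continuous_couplingVec : Continuous couplingVec := by
  unfold couplingVec
  refine (PiLp.continuous_toLp 2 _).comp (continuous_pi fun i => ?_)
  fin_cases i <;> simp <;> fun_prop

theorem continuous_couplingAtom :
    Continuous (fun u : ℝ => (!₂[u, 1, 0, 0] : EuclideanSpace ℝ (Fin 4))) ∧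
      Continuous (fun u : ℝ => (!₂[0, 0, u, 1] : EuclideanSpace ℝ (Fin 4))) := by
  constructor <;> refine (PiLp.continuous_toLp 2 _).comp (continuous_pi fun i => ?_) <;>
    fin_cases i <;> simp <;> fun_prop

theorem gaussianReal_map_affine (s m : ℝ) :
    (gaussianReal 0 1).map (fun u => s * u + m) = gaussianReal m (Real.toNNReal (s ^ 2)) := by
  have h : (fun u : ℝ => s * u + m) = (fun x => x + m) ∘ (fun u => s * u) := rfl
  rw [h, ← Measure.map_map (by fun_prop) (by fun_prop), gaussianReal_map_const_mul,
    gaussianReal_map_add_const]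
  congr 1
  · simp
  · rw [mul_one]
    exact (Real.toNNReal_of_nonneg (sq_nonneg s)).symm

theorem couplingMeasure_map (p : ℝ) (η : MixParam) :
    (couplingMeasure p).map (linScore (couplingVec η)) = mixMeasure p η := by
  have hm := measurable_linScore (couplingVec η)
  rw [couplingMeasure, Measure.map_add _ _ hm, Measure.map_smul, Measure.map_smul,
    Measure.map_map hm continuous_couplingAtom.1.measurable,
    Measure.map_map hm continuous_couplingAtom.2.measurable, mixMeasure]
  have h1 : (linScore (couplingVec η) ∘ fun u : ℝ => !₂[u, 1, 0, 0])
      = fun u => η.sd 1 * u + η.mean 1 := by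
    ext u
    simp [linScore, couplingVec, Fin.sum_univ_four, MixParam.sd, MixParam.mean]
  have h2 : (linScore (couplingVec η) ∘ fun u : ℝ => !₂[0, 0, u, 1])
      = fun u => η.sd (-1) * u + η.mean (-1) := by
    ext u
    simp [linScore, couplingVec, Fin.sum_univ_four, MixParam.sd, MixParam.mean]
  rw [h1, h2, gaussianReal_map_affine, gaussianReal_map_affine]
  rfl

theorem isProbabilityMeasure_couplingMeasure {p : ℝ} (hp0 : 0 < p) (hp1 : p < 1) :
    IsProbabilityMeasure (couplingMeasure p) := by
  constructor
  rw [couplingMeasure, Measure.add_apply, Measure.smul_apply, Measure.smul_apply,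
    Measure.map_apply continuous_couplingAtom.1.measurable .univ,
    Measure.map_apply continuous_couplingAtom.2.measurable .univ]
  simp only [Set.preimage_univ, measure_univ, smul_eq_mul, mul_one]
  rw [← ENNReal.ofReal_add hp0.le (by linarith)]
  simp

theorem memLp_couplingMeasure (p : ℝ) : MemLp id 2 (couplingMeasure p) := by
  rw [memLp_two_iff_integrable_sq_norm (by fun_prop), couplingMeasure]
  have hg : Integrable (fun u : ℝ => u ^ 2 + 1) (gaussianReal 0 1) :=
    ((memLp_id_gaussianReal' 2 (by norm_num)).integrable_sq).add (integrable_const _)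
  have hs : Continuous fun x : EuclideanSpace ℝ (Fin 4) => ‖id x‖ ^ 2 := by fun_prop
  refine Integrable.add_measure (Integrable.smul_measure ?_ ENNReal.ofReal_ne_top)
    (Integrable.smul_measure ?_ ENNReal.ofReal_ne_top)
  · rw [integrable_map_measure hs.aestronglyMeasurable
      continuous_couplingAtom.1.measurable.aemeasurable]
    refine hg.congr (ae_of_all _ fun u => ?_)
    simp [EuclideanSpace.norm_sq_eq, Fin.sum_univ_four]
  · rw [integrable_map_measure hs.aestronglyMeasurable
      continuous_couplingAtom.2.measurable.aemeasurable]
    refine hg.congr (ae_of_all _ fun u => ?_)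
    simp [EuclideanSpace.norm_sq_eq, Fin.sum_univ_four]

theorem exists_couplingVec_bound {E : Set MixParam} (hE : IsCompact E) :
    ∃ R : ℝ, ∀ η ∈ E, couplingVec η ∈ Metric.closedBall (0 : EuclideanSpace ℝ (Fin 4)) R := by
  obtain ⟨R, hR⟩ := hE.exists_bound_of_continuousOn continuous_couplingVec.continuousOn
  exact ⟨R, fun η h => mem_closedBall_zero_iff.2 (hR η h)⟩

/-! ### Empirical means and tail events -/

/-- The average of `g` over the first `n` points of the sample `z`. -/
noncomputable def empMean {Y : Type*} [AddCommGroup Y] [Module ℝ Y] (g : ℝ → Y) (n : ℕ)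
    (z : ℕ → ℝ) : Y := (n : ℝ)⁻¹ • ∑ i ∈ Finset.range n, g (z i)

theorem integrable_of_scoreMap {Y : Type*} [NormedAddCommGroup Y] [NormedSpace ℝ Y]
    {d : ℕ} {ν : Measure (EuclideanSpace ℝ (Fin d))} {R : ℝ} {g : C(ℝ, Y)}
    (hint : Integrable (scoreMap R g) ν)
    (θ : Metric.closedBall (0 : EuclideanSpace ℝ (Fin d)) R) :
    Integrable g (ν.map (linScore (θ : EuclideanSpace ℝ (Fin d)))) := by
  rw [integrable_map_measure g.continuous.stronglyMeasurable.aestronglyMeasurable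
    (measurable_linScore _).aemeasurable]
  exact (ContinuousMap.evalCLM ℝ θ).integrable_comp hint

theorem empMean_scoreMap_apply {Y : Type*} [NormedAddCommGroup Y] [NormedSpace ℝ Y]
    {d : ℕ} {R : ℝ} (g : C(ℝ, Y)) (n : ℕ) (x : ℕ → EuclideanSpace ℝ (Fin d))
    (θ : Metric.closedBall (0 : EuclideanSpace ℝ (Fin d)) R) :
    ((n : ℝ)⁻¹ • ∑ i ∈ Finset.range n, scoreMap R g (x i)) θ
      = empMean g n (fun i => linScore (θ : EuclideanSpace ℝ (Fin d)) (x i)) := by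
  simp [empMean]

/-- The events decrease in `n`, and on their intersection `f` does not tend to 0; continuity from
above applies. -/
theorem tendsto_measure_exists_ge_of_ae_tendsto {Ω : Type*} [MeasurableSpace Ω] {P : Measure Ω}
    [IsFiniteMeasure P] {f : ℕ → Ω → ℝ} (hf : ∀ n, Measurable (f n))
    (h : ∀ᵐ ω ∂P, Tendsto (fun n => f n ω) atTop (𝓝 0)) {δ : ℝ} (hδ : 0 < δ) :
    Tendsto (fun n => P {ω | ∃ m, n ≤ m ∧ δ ≤ f m ω}) atTop (𝓝 0) := by
  have hm : ∀ n, MeasurableSet {ω | ∃ m, n ≤ m ∧ δ ≤ f m ω} := fun n => by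
    have : {ω | ∃ m, n ≤ m ∧ δ ≤ f m ω} = ⋃ m, ⋃ (_ : n ≤ m), {ω | δ ≤ f m ω} := by
      ext ω
      simp
    rw [this]
    exact .iUnion fun m => .iUnion fun _ => measurableSet_le measurable_const (hf m)
  have key := tendsto_measure_iInter_atTop (μ := P) (fun n => (hm n).nullMeasurableSet)
    (fun n n' hn ω ⟨m, hm, hω⟩ => ⟨m, hn.trans hm, hω⟩) ⟨0, measure_ne_top _ _⟩
  have h0 : P (⋂ n, {ω | ∃ m, n ≤ m ∧ δ ≤ f m ω}) = 0 := by
    refine measure_mono_null ?_ (ae_iff.1 h)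
    intro ω hω hlim
    obtain ⟨n, hn⟩ := eventually_atTop.1 (hlim.eventually (gt_mem_nhds hδ))
    obtain ⟨m, hm, hδm⟩ := Set.mem_iInter.1 hω n
    exact (hn m hm).not_ge hδm
  rwa [h0] at key

/-! ### Consistency, uniform in the true parameter -/

section Consistency

variable {p : ℝ} {E : Set MixParam} [CompactSpace E] {g : C(ℝ, C(E, ℝ))} {C : ℝ}

theorem integral_mixMeasure_eq_scoreMap {R : ℝ}
    (hint : Integrable (scoreMap R g) (couplingMeasure p)) {η₀ : MixParam}
    (h : couplingVec η₀ ∈ Metric.closedBall (0 : EuclideanSpace ℝ (Fin 4)) R) :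
    (∫ x, scoreMap R g x ∂(couplingMeasure p)) ⟨couplingVec η₀, h⟩
      = ∫ z, g z ∂(mixMeasure p η₀) := by
  rw [integral_scoreMap_apply hint, couplingMeasure_map]

/-- If the empirical mean log-likelihood is uniformly close to its expectation, then the maximum
likelihood estimate is close to the true parameter, uniformly in the latter. -/
theorem exists_pos_forall_norm_mle_sub_lt (hp0 : 0 < p) (hp1 : p < 1) (hp : p ≠ 1 - p)
    (hEsd : ∀ η ∈ E, 0 < η.sd 1 ∧ 0 < η.sd (-1)) (hC : 0 ≤ C)
    (hg : ∀ z η, g z η = Real.log (mixPDF p η z)) (hgC : ∀ z, ‖g z‖ ≤ C * (1 + z ^ 2))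
    {etaHat : (n : ℕ) → (Fin n → ℝ) → MixParam} (hetaHat : IsMixMLE p E etaHat)
    {ε : ℝ} (hε : 0 < ε) :
    ∃ δ > 0, ∀ η₀ ∈ E, ∀ (n : ℕ) (z : ℕ → ℝ),
      ‖empMean g n z - ∫ z, g z ∂(mixMeasure p η₀)‖ < δ →
        ‖etaHat n (fun i : Fin n => z i) - η₀‖ < ε := by
  have hE : IsCompact E := isCompact_iff_compactSpace.2 inferInstance
  obtain ⟨R, hR⟩ := exists_couplingVec_bound hE
  have := isProbabilityMeasure_couplingMeasure hp0 hp1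
  have hint : Integrable (scoreMap R g) (couplingMeasure p) :=
    integrable_scoreMap hC hgC (memLp_couplingMeasure p)
  have hgint : ∀ η₀ ∈ E, Integrable g (mixMeasure p η₀) := fun η₀ h => by
    simpa only [couplingMeasure_map] using integrable_of_scoreMap hint ⟨_, hR η₀ h⟩
  let H : E → C(E, ℝ) := fun η₀ => ∫ z, g z ∂(mixMeasure p η₀)
  have hH : Continuous H := by
    have : H = fun η₀ : E => (∫ x, scoreMap R g x ∂(couplingMeasure p))
        ⟨couplingVec η₀, hR η₀ η₀.2⟩ :=
      funext fun η₀ => (integral_mixMeasure_eq_scoreMap hint (hR η₀ η₀.2)).symm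
    rw [this]
    exact (map_continuous _).comp
      ((continuous_couplingVec.comp continuous_subtype_val).subtype_mk _)
  have hHapp : ∀ η₀ η : E, H η₀ η = ∫ z, Real.log (mixPDF p η z) ∂(mixMeasure p η₀) := by
    intro η₀ η
    simp only [H, ← hg]
    exact ContinuousMap.integral_apply (hgint η₀ η₀.2) η
  have hlog : ∀ η₀ η : E, Integrable (fun z => Real.log (mixPDF p η z)) (mixMeasure p η₀) := by
    intro η₀ η
    simp only [← hg]
    exact (ContinuousMap.evalCLM ℝ η).integrable_comp (hgint η₀ η₀.2)
  let φ : E × E → ℝ := fun q => H q.1 q.1 - H q.1 q.2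
  have hφ : Continuous φ :=
    (((hH.comp continuous_fst).eval continuous_fst).sub
      ((hH.comp continuous_fst).eval continuous_snd))
  let K : Set (E × E) := {q | ε ≤ ‖(q.2 : MixParam) - q.1‖}
  have hK : IsCompact K := (isClosed_le (by fun_prop) (by fun_prop)).isCompact
  -- `φ` is the loss in expected log-likelihood, positive off the diagonal by the Gibbs inequality.
  -- A positive `δ` is obtained even if `K` is empty.
  obtain ⟨δ, hδ, hδK⟩ := hK.exists_forall_le' hφ.continuousOn (a := 0) (by
    rintro ⟨η₀, η⟩ hq
    simp only [φ, hHapp, sub_pos]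
    refine integral_log_mixPDF_lt hp0 hp1 hp (hEsd _ η.2) (hEsd _ η₀.2) ?_ (hlog _ _) (hlog _ _)
    rintro h
    have hq' : ε ≤ ‖(η : MixParam) - η₀‖ := hq
    rw [h, sub_self, norm_zero] at hq'
    exact hε.not_ge hq')
  -- The approximation error is paid twice, at `η₀` and at the estimate.
  refine ⟨δ / 2, half_pos hδ, fun η₀ hη₀ n z hclose => ?_⟩
  by_contra hcon
  rw [not_lt] at hcon
  obtain ⟨hmem, hmax⟩ := hetaHat n (fun i : Fin n => z i)
  set η := etaHat n (fun i : Fin n => z i) with hη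
  have h1 : δ ≤ H ⟨η₀, hη₀⟩ ⟨η₀, hη₀⟩ - H ⟨η₀, hη₀⟩ ⟨η, hmem⟩ :=
    hδK (⟨η₀, hη₀⟩, ⟨η, hmem⟩) hcon
  have hS : ∀ η : E, empMean g n z η = (n : ℝ)⁻¹ * mixLogLik p (fun i : Fin n => z i) η := by
    intro η
    simp [empMean, mixLogLik, Finset.sum_range, hg]
  have h2 : empMean g n z ⟨η₀, hη₀⟩ ≤ empMean g n z ⟨η, hmem⟩ := by
    rw [hS, hS]
    exact mul_le_mul_of_nonneg_left (hmax hη₀) (by positivity)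
  have hd : ∀ η : E, |empMean g n z η - H ⟨η₀, hη₀⟩ η| < δ / 2 := fun η =>
    ((empMean g n z - H ⟨η₀, hη₀⟩).norm_coe_le_norm η).trans_lt hclose
  have h3 := abs_lt.1 (hd ⟨η₀, hη₀⟩)
  have h4 := abs_lt.1 (hd ⟨η, hmem⟩)
  linarith [h3.1, h4.2]

theorem tendsto_iSup_mle_error (hp0 : 0 < p) (hp1 : p < 1) (hp : p ≠ 1 - p)
    (hEsd : ∀ η ∈ E, 0 < η.sd 1 ∧ 0 < η.sd (-1)) (hC : 0 ≤ C)
    (hg : ∀ z η, g z η = Real.log (mixPDF p η z)) (hgC : ∀ z, ‖g z‖ ≤ C * (1 + z ^ 2))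
    {etaHat : (n : ℕ) → (Fin n → ℝ) → MixParam} (hetaHat : IsMixMLE p E etaHat)
    {ε : ℝ} (hε : 0 < ε) :
    Tendsto (fun n : ℕ => ⨆ η₀ ∈ E,
      Measure.infinitePi (fun _ : ℕ => mixMeasure p η₀)
        {z : ℕ → ℝ | ∃ m : ℕ, n ≤ m ∧ ε ≤ ‖etaHat m (fun i : Fin m => z i) - η₀‖})
      atTop (𝓝 (0 : ℝ≥0∞)) := by
  have hE : IsCompact E := isCompact_iff_compactSpace.2 inferInstance
  obtain ⟨R, hR⟩ := exists_couplingVec_bound hE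
  have := isProbabilityMeasure_couplingMeasure hp0 hp1
  have hint : Integrable (scoreMap R g) (couplingMeasure p) :=
    integrable_scoreMap hC hgC (memLp_couplingMeasure p)
  obtain ⟨δ, hδ, hmle⟩ := exists_pos_forall_norm_mle_sub_lt hp0 hp1 hp hEsd hC hg hgC hetaHat hε
  let ν := couplingMeasure p
  let L := ∫ x, scoreMap R g x ∂ν
  let f : ℕ → (ℕ → EuclideanSpace ℝ (Fin 4)) → ℝ := fun n x =>
    ‖(n : ℝ)⁻¹ • ∑ i ∈ Finset.range n, scoreMap R g (x i) - L‖
  have hf : ∀ n, Measurable (f n) := fun n => by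
    have hsum : Continuous fun x : ℕ → EuclideanSpace ℝ (Fin 4) =>
        ∑ i ∈ Finset.range n, scoreMap R g (x i) :=
      continuous_finsetSum _ fun i _ => (scoreMap R g).continuous.comp (continuous_apply i)
    exact ((hsum.const_smul ((n : ℝ)⁻¹)).sub continuous_const).norm.measurable
  have hlim : ∀ᵐ x ∂(Measure.infinitePi fun _ : ℕ => ν),
      Tendsto (fun n => f n x) atTop (𝓝 0) := by
    have hlln := strong_law_scoreMap hint (P := Measure.infinitePi fun _ : ℕ => ν)
      (Z := fun i x => x i) (iIndepFun_infinitePi (X := fun _ x => x) fun _ => measurable_id)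
      (fun i => ⟨(measurable_pi_apply i).aemeasurable, Measure.infinitePi_map_eval _ i⟩)
    filter_upwards [hlln] with x hx
    exact tendsto_iff_norm_sub_tendsto_zero.1 hx
  refine tendsto_of_tendsto_of_tendsto_of_le_of_le tendsto_const_nhds
    (tendsto_measure_exists_ge_of_ae_tendsto hf hlim hδ) (fun n => zero_le) (fun n => ?_)
  refine iSup₂_le fun η₀ hη₀ => ?_
  let H := ∫ z, g z ∂(mixMeasure p η₀)
  -- `etaHat` need not be measurable, so the error event is first enclosed in the measurable set
  -- `D`, which can be pulled back to the coupling space.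
  let D : Set (ℕ → ℝ) := {z | ∃ m, n ≤ m ∧ δ ≤ ‖empMean g m z - H‖}
  have hD : MeasurableSet D := by
    have : D = ⋃ m, ⋃ (_ : n ≤ m), {z | δ ≤ ‖empMean g m z - H‖} := by
      ext z
      simp [D]
    rw [this]
    refine .iUnion fun m => .iUnion fun _ => measurableSet_le measurable_const ?_
    have hsum : Continuous fun z : ℕ → ℝ => ∑ i ∈ Finset.range m, g (z i) :=
      continuous_finsetSum _ fun i _ => g.continuous.comp (continuous_apply i)
    exact ((hsum.const_smul ((m : ℝ)⁻¹)).sub continuous_const).norm.measurable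
  have hmeas := measurable_linScore (couplingVec η₀)
  have hmap : Measure.infinitePi (fun _ : ℕ => mixMeasure p η₀)
      = (Measure.infinitePi fun _ : ℕ => ν).map
        (fun x i => linScore (couplingVec η₀) (x i)) := by
    rw [Measure.infinitePi_map_pi (μ := fun _ : ℕ => ν)
      (f := fun _ : ℕ => linScore (couplingVec η₀)) fun _ => hmeas]
    simp only [ν, couplingMeasure_map]
  refine (measure_mono (t := D) ?_).trans ?_
  · rintro z ⟨m, hm, hz⟩
    exact ⟨m, hm, not_lt.1 fun h => (hmle η₀ hη₀ m z h).not_ge hz⟩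
  · rw [hmap, Measure.map_apply (by fun_prop) hD]
    refine measure_mono fun x => ?_
    rintro ⟨m, hm, hx⟩
    refine ⟨m, hm, hx.trans ?_⟩
    have := ((m : ℝ)⁻¹ • ∑ i ∈ Finset.range m, scoreMap R g (x i) - L).norm_coe_le_norm
      ⟨couplingVec η₀, hR η₀ hη₀⟩
    rwa [ContinuousMap.sub_apply, empMean_scoreMap_apply,
      integral_mixMeasure_eq_scoreMap hint (hR η₀ hη₀)] at this

end Consistency

/-! ### Scores of unlabeled data and their `L²` coordinates -/

theorem restrict_eq_smul_cond {α : Type*} [MeasurableSpace α] (ρ : Measure α) [IsFiniteMeasure ρ]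
    (s : Set α) : ρ.restrict s = ρ s • ProbabilityTheory.cond ρ s := by
  rw [ProbabilityTheory.cond, smul_smul]
  by_cases h : ρ s = 0
  · rw [Measure.restrict_eq_zero.2 h, smul_zero]
  · rw [ENNReal.mul_inv_cancel h (measure_ne_top _ _), one_smul]

/-- Normality of the score given the label determines the unconditional law of the score. -/
theorem ScoreIsNormalGivenLabel.map_linScore {d : ℕ} {p : ℝ} (hp0 : 0 < p) (hp1 : p < 1)
    {ρ : Measure (EuclideanSpace ℝ (Fin d) × ℤ)} [IsProbabilityMeasure ρ]
    (h1 : ρ.real (Prod.snd ⁻¹' {1}) = p) (h2 : ρ.real (Prod.snd ⁻¹' {-1}) = 1 - p)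
    {θ : EuclideanSpace ℝ (Fin d)} {η : MixParam} (h : ScoreIsNormalGivenLabel ρ θ η) :
    (ρ.map Prod.fst).map (linScore θ) = mixMeasure p η := by
  have hf : Measurable fun xy : EuclideanSpace ℝ (Fin d) × ℤ => linScore θ xy.1 :=
    (measurable_linScore θ).comp measurable_fst
  set s : Set (EuclideanSpace ℝ (Fin d) × ℤ) := Prod.snd ⁻¹' {1} with hs
  set t : Set (EuclideanSpace ℝ (Fin d) × ℤ) := Prod.snd ⁻¹' {-1} with ht
  have hsm : MeasurableSet s := measurable_snd (measurableSet_singleton _)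
  have htm : MeasurableSet t := measurable_snd (measurableSet_singleton _)
  have hst : Disjoint s t := Disjoint.preimage _ (by simp)
  have hs' : ρ s = ENNReal.ofReal p := by rw [← h1, ofReal_measureReal]
  have ht' : ρ t = ENNReal.ofReal (1 - p) := by rw [← h2, ofReal_measureReal]
  have hu : ρ (s ∪ t) = 1 := by
    rw [measure_union hst htm, hs', ht', ← ENNReal.ofReal_add hp0.le (by linarith)]
    simp
  have hρ : ρ = ρ.restrict s + ρ.restrict t := by
    rw [← Measure.restrict_union hst htm]
    exact (Measure.restrict_eq_self_of_ae_mem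
      ((prob_compl_eq_zero_iff (hsm.union htm)).2 hu)).symm
  rw [Measure.map_map (measurable_linScore θ) measurable_fst]
  change ρ.map (fun xy => linScore θ xy.1) = _
  rw [hρ, Measure.map_add _ _ hf, restrict_eq_smul_cond, restrict_eq_smul_cond, Measure.map_smul,
    Measure.map_smul, h 1 (Or.inl rfl), h (-1) (Or.inr rfl), hs', ht', mixMeasure]

theorem linScore_add {d : ℕ} (θ θ' x : EuclideanSpace ℝ (Fin d)) :
    linScore (θ + θ') x = linScore θ x + linScore θ' x := by
  simp [linScore, add_mul, Finset.sum_add_distrib]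

theorem linScore_smul {d : ℕ} (a : ℝ) (θ x : EuclideanSpace ℝ (Fin d)) :
    linScore (a • θ) x = a * linScore θ x := by
  simp [linScore, Finset.mul_sum, mul_assoc]

/-- The linear score as a linear functional of the coefficients. -/
def linScoreLinearMap {d : ℕ} (x : EuclideanSpace ℝ (Fin d)) :
    EuclideanSpace ℝ (Fin d) →ₗ[ℝ] ℝ where
  toFun θ := linScore θ x
  map_add' θ θ' := linScore_add θ θ' x
  map_smul' a θ := linScore_smul a θ x

@[simp]
theorem linScoreLinearMap_apply {d : ℕ} (θ x : EuclideanSpace ℝ (Fin d)) :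
    linScoreLinearMap x θ = linScore θ x := rfl

/-- The coefficient vectors with square integrable score. -/
def squareIntegrableScores {d : ℕ} (κ : Measure (EuclideanSpace ℝ (Fin d))) :
    Submodule ℝ (EuclideanSpace ℝ (Fin d)) where
  carrier := {θ | MemLp (linScore θ) 2 κ}
  add_mem' {θ θ'} h h' := by
    have e : linScore (θ + θ') = linScore θ + linScore θ' := funext fun x => linScore_add θ θ' x
    simp only [Set.mem_ofPred_eq, e]
    exact MemLp.add h h'
  zero_mem' := by
    have : linScore (0 : EuclideanSpace ℝ (Fin d)) = 0 := by
      ext x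
      simp [linScore]
    simp [this]
  smul_mem' a θ h := by
    have e : linScore (a • θ) = a • linScore θ := funext fun x => linScore_smul a θ x
    simp only [Set.mem_ofPred_eq, e]
    exact MemLp.const_smul h a

theorem memLp_linScore {d : ℕ} {κ : Measure (EuclideanSpace ℝ (Fin d))}
    (θ : squareIntegrableScores κ) : MemLp (linScore θ.1) 2 κ := θ.2

/-- The score as an element of `L²`, as a linear map. -/
noncomputable def scoreToLp {d : ℕ} (κ : Measure (EuclideanSpace ℝ (Fin d))) :
    squareIntegrableScores κ →ₗ[ℝ] Lp ℝ 2 κ where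
  toFun θ := (memLp_linScore θ).toLp
  map_add' θ θ' := (MemLp.toLp_congr _ ((memLp_linScore θ).add (memLp_linScore θ'))
    (ae_of_all _ fun x => linScore_add _ _ x)).trans (MemLp.toLp_add _ _)
  map_smul' a θ := (MemLp.toLp_congr _ ((memLp_linScore θ).const_smul a)
    (ae_of_all _ fun x => linScore_smul _ _ x)).trans (MemLp.toLp_const_smul _ _)

/-- A family of linear scores bounded in `L²` is, almost surely, a bounded family of linear scores
of finitely many square integrable scores. -/
theorem exists_bounded_score_coordinates {d : ℕ} {κ : Measure (EuclideanSpace ℝ (Fin d))}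
    {Θ : Set (EuclideanSpace ℝ (Fin d))} {M : ℝ≥0∞} (hM : M ≠ ∞)
    (hΘ : ∀ θ ∈ Θ, eLpNorm (linScore θ) 2 κ ≤ M) :
    ∃ (k : ℕ) (v : Fin k → EuclideanSpace ℝ (Fin d))
      (c : EuclideanSpace ℝ (Fin d) → EuclideanSpace ℝ (Fin k)) (R : ℝ),
      (∀ j, MemLp (linScore (v j)) 2 κ) ∧ (∀ θ ∈ Θ, c θ ∈ Metric.closedBall 0 R) ∧
      ∀ᵐ x ∂κ, ∀ θ ∈ Θ,
        linScore (c θ) (WithLp.toLp 2 fun j => linScore (v j) x) = linScore θ x := by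
  classical
  have hmem : ∀ θ ∈ Θ, θ ∈ squareIntegrableScores κ := fun θ h =>
    ⟨(measurable_linScore θ).aestronglyMeasurable, (hΘ θ h).trans_lt hM.lt_top⟩
  let T := scoreToLp κ
  let b := stdOrthonormalBasis ℝ (LinearMap.range T)
  choose v hv using fun j => (b j).2
  -- Coordinates of the score in an orthonormal basis of the range of `T`: the norm of `c θ` is the
  -- `L²` norm of the score, whatever the size of `θ`.
  let c : squareIntegrableScores κ →ₗ[ℝ] EuclideanSpace ℝ (Fin _) :=
    b.repr.toLinearEquiv.toLinearMap ∘ₗ T.rangeRestrict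
  have hc : ∀ θ, ‖c θ‖ = ‖T θ‖ := fun θ => b.repr.norm_map _
  let Z : EuclideanSpace ℝ (Fin d) → EuclideanSpace ℝ (Fin _) :=
    fun x => WithLp.toLp 2 fun j => linScore (v j : EuclideanSpace ℝ (Fin d)) x
  have hZ : ∀ θ : squareIntegrableScores κ, ∀ᵐ x ∂κ,
      linScore (c θ) (Z x) = linScore (θ : EuclideanSpace ℝ (Fin d)) x := by
    intro θ
    have h1 : T (∑ j, c θ j • v j) = T θ := by
      have h2 := congrArg Subtype.val (b.sum_repr (T.rangeRestrict θ))
      simp only [Submodule.coe_sum, Submodule.coe_smul] at h2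
      rw [map_sum]
      refine Eq.trans ?_ h2
      refine Finset.sum_congr rfl fun j _ => ?_
      rw [map_smul, hv]
      rfl
    filter_upwards [(MemLp.toLp_eq_toLp_iff (memLp_linScore _) (memLp_linScore _)).1 h1] with x hx
    rw [← hx, ← linScoreLinearMap_apply _ x]
    simp only [Submodule.coe_sum, Submodule.coe_smul, map_sum, map_smul, linScoreLinearMap_apply]
    simp [linScore, Z]
  refine ⟨_, fun j => v j, fun θ => if h : θ ∈ squareIntegrableScores κ then c ⟨θ, h⟩ else 0,
    M.toReal, fun j => (v j).2, fun θ h => ?_, ?_⟩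
  · beta_reduce
    rw [dif_pos (hmem θ h), mem_closedBall_zero_iff, hc]
    refine (Lp.norm_toLp _ (hmem θ h)).trans_le ?_
    exact ENNReal.toReal_mono hM (hΘ θ h)
  -- The null set must not depend on `θ`. Both sides are linear in `θ`, so agreement on a finite
  -- basis suffices.
  · let e := Module.finBasis ℝ (squareIntegrableScores κ)
    filter_upwards [ae_all_iff.2 fun i => hZ (e i)] with x hx θ h
    have key : linScoreLinearMap (Z x) ∘ₗ c
        = linScoreLinearMap x ∘ₗ (squareIntegrableScores κ).subtype := e.ext hx
    rw [dif_pos (hmem θ h)]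
    exact LinearMap.congr_fun key ⟨θ, hmem θ h⟩

theorem measurable_scoreVector {d k : ℕ} (v : Fin k → EuclideanSpace ℝ (Fin d)) :
    Measurable fun x => (WithLp.toLp 2 fun j => linScore (v j) x : EuclideanSpace ℝ (Fin k)) :=
  (WithLp.measurable_toLp 2 _).comp (measurable_pi_lambda _ fun j => measurable_linScore (v j))

theorem memLp_map_scoreVector {d k : ℕ} {κ : Measure (EuclideanSpace ℝ (Fin d))}
    {v : Fin k → EuclideanSpace ℝ (Fin d)} (hv : ∀ j, MemLp (linScore (v j)) 2 κ) :
    MemLp id 2 (κ.map fun x =>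
      (WithLp.toLp 2 fun j => linScore (v j) x : EuclideanSpace ℝ (Fin k))) := by
  have hm := measurable_scoreVector v
  rw [memLp_map_measure_iff (by fun_prop) hm.aemeasurable,
    memLp_two_iff_integrable_sq_norm (measurable_id.comp hm).aestronglyMeasurable]
  simp only [Function.comp_apply, id_eq, EuclideanSpace.norm_sq_eq, Real.norm_eq_abs, sq_abs]
  exact integrable_finsetSum _ fun j _ => (hv j).integrable_sq

/-- Under the coupling, `id` becomes a linear score with coefficients of norm at most `R`. -/
theorem exists_eLpNorm_mixMeasure_le (p : ℝ) {E : Set MixParam} (hE : IsCompact E) :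
    ∃ M : ℝ≥0∞, M ≠ ∞ ∧ ∀ η ∈ E, eLpNorm id 2 (mixMeasure p η) ≤ M := by
  obtain ⟨R, hR⟩ := exists_couplingVec_bound hE
  refine ⟨ENNReal.ofReal R * eLpNorm id 2 (couplingMeasure p),
    ENNReal.mul_ne_top ENNReal.ofReal_ne_top (memLp_couplingMeasure p).2.ne, fun η hη => ?_⟩
  rw [← couplingMeasure_map, eLpNorm_map_measure (by fun_prop)
    (measurable_linScore _).aemeasurable]
  refine eLpNorm_le_mul_eLpNorm_of_ae_le_mul (ae_of_all _ fun x => ?_) 2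
  refine (abs_linScore_le _ x).trans ?_
  exact mul_le_mul_of_nonneg_right (mem_closedBall_zero_iff.1 (hR η hη)) (norm_nonneg _)

/-- The uniform law is applied to the vectors `Z (X i)`, which are square integrable, with
coefficients `c θ` in a ball; almost surely the scores are unchanged for all `θ ∈ Θ` at once. -/
theorem ae_tendstoUniformlyOn_mle {p : ℝ} {E : Set MixParam} [CompactSpace E]
    {g : C(ℝ, C(E, ℝ))} {C : ℝ} (hp0 : 0 < p) (hp1 : p < 1) (hp : p ≠ 1 - p)
    (hEsd : ∀ η ∈ E, 0 < η.sd 1 ∧ 0 < η.sd (-1)) (hC : 0 ≤ C)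
    (hg : ∀ z η, g z η = Real.log (mixPDF p η z)) (hgC : ∀ z, ‖g z‖ ≤ C * (1 + z ^ 2))
    {etaHat : (n : ℕ) → (Fin n → ℝ) → MixParam} (hetaHat : IsMixMLE p E etaHat)
    {d : ℕ} {κ : Measure (EuclideanSpace ℝ (Fin d))} [IsProbabilityMeasure κ]
    {Θ : Set (EuclideanSpace ℝ (Fin d))} {eta : EuclideanSpace ℝ (Fin d) → MixParam}
    (hΘ : ∀ θ ∈ Θ, eta θ ∈ E ∧ κ.map (linScore θ) = mixMeasure p (eta θ))
    {Ω : Type*} [MeasurableSpace Ω] {P : Measure Ω} {X : ℕ → Ω → EuclideanSpace ℝ (Fin d)}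
    (hind : iIndepFun X P) (hX : ∀ i, HasLaw (X i) κ P) :
    ∀ᵐ ω ∂P, TendstoUniformlyOn
      (fun (n : ℕ) (θ : EuclideanSpace ℝ (Fin d)) =>
        etaHat n (fun i : Fin n => linScore θ (X i ω))) eta atTop Θ := by
  have hE : IsCompact E := isCompact_iff_compactSpace.2 inferInstance
  obtain ⟨M, hM, hME⟩ := exists_eLpNorm_mixMeasure_le p hE
  obtain ⟨k, v, c, R, hv, hcR, hc⟩ := exists_bounded_score_coordinates (κ := κ) (Θ := Θ) hM
    fun θ hθ => by
      have := hME _ (hΘ θ hθ).1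
      rwa [← (hΘ θ hθ).2, eLpNorm_map_measure (by fun_prop)
        (measurable_linScore _).aemeasurable] at this
  let Z : EuclideanSpace ℝ (Fin d) → EuclideanSpace ℝ (Fin k) :=
    fun x => WithLp.toLp 2 fun j => linScore (v j) x
  have hZ : Measurable Z := measurable_scoreVector v
  have : IsProbabilityMeasure (κ.map Z) := Measure.isProbabilityMeasure_map hZ.aemeasurable
  have hint : Integrable (scoreMap R g) (κ.map Z) :=
    integrable_scoreMap hC hgC (memLp_map_scoreVector hv)
  have hlln := strong_law_scoreMap hint (P := P) (Z := fun i => Z ∘ X i)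
    (hind.comp (fun _ => Z) fun _ => hZ)
    (fun i => HasLaw.comp ⟨hZ.aemeasurable, rfl⟩ (hX i))
  have hcX : ∀ i, ∀ᵐ ω ∂P, ∀ θ ∈ Θ, linScore (c θ) (Z (X i ω)) = linScore θ (X i ω) := fun i =>
    ae_of_ae_map (hX i).aemeasurable (by rwa [(hX i).map_eq])
  filter_upwards [hlln, ae_all_iff.2 hcX] with ω hω hcω
  rw [Metric.tendstoUniformlyOn_iff]
  intro ε hε
  obtain ⟨δ, hδ, hmle⟩ := exists_pos_forall_norm_mle_sub_lt hp0 hp1 hp hEsd hC hg hgC hetaHat hε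
  filter_upwards [(tendsto_iff_norm_sub_tendsto_zero.1 hω).eventually (gt_mem_nhds hδ)]
    with n hn θ hθ
  rw [dist_comm, dist_eq_norm]
  refine hmle _ (hΘ θ hθ).1 n (fun i => linScore θ (X i ω)) (lt_of_le_of_lt ?_ hn)
  have key := ((n : ℝ)⁻¹ • ∑ i ∈ Finset.range n, scoreMap R g ((Z ∘ X i) ω)
    - ∫ x, scoreMap R g x ∂(κ.map Z)).norm_coe_le_norm ⟨c θ, hcR θ hθ⟩
  have hlaw : (κ.map Z).map (linScore (c θ)) = mixMeasure p (eta θ) := by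
    rw [Measure.map_map (measurable_linScore _) hZ, ← (hΘ θ hθ).2]
    refine Measure.map_congr ?_
    filter_upwards [hc] with x hx using hx θ hθ
  rw [ContinuousMap.sub_apply, empMean_scoreMap_apply g n (fun i => (Z ∘ X i) ω),
    integral_scoreMap_apply hint, hlaw] at key
  simpa only [Function.comp_apply, hcω _ θ hθ] using key

theorem mainTheorem5
    -- the known label marginals `p(Y = 1) = p` and `p(Y = -1) = 1 - p`
    (p : ℝ) (hp0 : 0 < p) (hp1 : p < 1) (hp : p ≠ 1 - p)
    -- the compact parameter set, with positive standard deviations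
    (E : Set MixParam) (hE : IsCompact E) (hEsd : ∀ η ∈ E, 0 < η.sd 1 ∧ 0 < η.sd (-1))
    -- the maximum likelihood estimator over `E`
    (etaHat : (n : ℕ) → (Fin n → ℝ) → MixParam) (hetaHat : IsMixMLE p E etaHat) :
    -- uniformity in `η₀ ∈ E`, for i.i.d. samples from the mixture with parameter `η₀`
    (∀ ε : ℝ, 0 < ε →
      Tendsto (fun n : ℕ => ⨆ η₀ ∈ E,
          Measure.infinitePi (fun _ : ℕ => mixMeasure p η₀)
            {z : ℕ → ℝ | ∃ m : ℕ, n ≤ m ∧ ε ≤ ‖etaHat m (fun i : Fin m => z i) - η₀‖})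
        atTop (𝓝 (0 : ℝ≥0∞))) ∧
    -- uniformity in `θ ∈ Θ`, for i.i.d. unlabeled data `X⁽¹⁾, X⁽²⁾, …`
    (∀ (d : ℕ) (ρ : Measure (EuclideanSpace ℝ (Fin d) × ℤ)), IsProbabilityMeasure ρ →
      ρ.real (Prod.snd ⁻¹' {1}) = p → ρ.real (Prod.snd ⁻¹' {-1}) = 1 - p →
      ∀ (Θ : Set (EuclideanSpace ℝ (Fin d))) (eta : EuclideanSpace ℝ (Fin d) → MixParam),
      (∀ θ ∈ Θ, eta θ ∈ E ∧ ScoreIsNormalGivenLabel ρ θ (eta θ)) →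
      ∀ (Ω : Type*) [MeasurableSpace Ω] (P : Measure Ω) [IsProbabilityMeasure P]
        (X : ℕ → Ω → EuclideanSpace ℝ (Fin d)),
      iIndepFun X P → (∀ i, HasLaw (X i) (ρ.map Prod.fst) P) →
      ∀ᵐ ω ∂P, TendstoUniformlyOn
        (fun (n : ℕ) (θ : EuclideanSpace ℝ (Fin d)) =>
          etaHat n (fun i : Fin n => linScore θ (X i ω)))
        eta atTop Θ) := by
  have : CompactSpace E := isCompact_iff_compactSpace.1 hE
  obtain ⟨g, C, hC, hg, hgC'⟩ := exists_logMixPDF_curve hp0 hp1 hE hEsd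
  have hgC : ∀ z, ‖g z‖ ≤ C * (1 + z ^ 2) := fun z =>
    (ContinuousMap.norm_le _ (by positivity)).2 fun η => hgC' z η
  refine ⟨fun ε hε => tendsto_iSup_mle_error hp0 hp1 hp hEsd hC hg hgC hetaHat hε, ?_⟩
  intro d ρ hρ h1 h2 Θ eta hΘ Ω _ P _ X hind hX
  have : IsProbabilityMeasure (ρ.map Prod.fst) :=
    Measure.isProbabilityMeasure_map measurable_fst.aemeasurable
  exact ae_tendstoUniformlyOn_mle hp0 hp1 hp hEsd hC hg hgC hetaHat
    (fun θ hθ => ⟨(hΘ θ hθ).1, (hΘ θ hθ).2.map_linScore hp0 hp1 h1 h2⟩) hind hX
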